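/- Let $k,l\ge 1$ be integers and let $R$ be a commutative ring with $1$. For $m\in\mathbb{Z}^k$ put $|m|=m_1+\dots+m_k$, and order $\mathbb{Z}^k$ componentwise. Let $\Lambda$ be the standard $k$-graph of level $l$: its vertex set is $\Lambda^0=\mathbb{Z}^k$, its paths (morphisms) are the triples $(v,w,p)$ with $v,w\in\mathbb{Z}^k$, $v\ge w$ and $p\in\{1,\dots,l\}^{|v-w|}$, with range $r(v,w,p)=v$, source $s(v,w,p)=w$, degree $d(v,w,p)=v-w\in\mathbb{N}^k$ and composition $(u,v,p)\circ(v,w,q)=(u,w,p\times q)$, where $p\times q$ is the concatenation; a vertex $v$ is identified with $(v,v,())$. Let $\Lambda^{\neq 0}$ be the set of paths of nonzero degree, let $v\Lambda^n$ be the set of paths of range $v$ and degree $n$, and let $\lambda\mapsto\lambda^*$ be a bijection from $\Lambda^{\ne 0}$ onto a set of symbols (ghost paths) disjoint from $\Lambda$. The Kumjian–Pask algebra $KP_R(\Lambda)$ is the associative, not necessarily unital, $R$-algebra presented by the generators $\Lambda^0\cup\Lambda^{\neq 0}\cup(\Lambda^{\neq 0})^*$ and the relations 1. $vw=\delta_{v,w}v$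 for $v,w\in\Lambda^0$; 2. $\lambda\mu=\lambda\circ\mu$ and $\mu^*\lambda^*=(\lambda\circ\mu)^*$ for $\lambda,\mu\in\Lambda^{\neq0}$ with $s(\lambda)=r(\mu)$, and $r(\lambda)\lambda=\lambda=\lambda s(\lambda)$, $s(\lambda)\lambda^*=\lambda^*=\lambda^*r(\lambda)$ for $\lambda\in\Lambda^{\neq 0}$; 3. $\lambda^*\mu=\delta_{\lambda,\mu}s(\lambda)$ for $\lambda,\mu\in\Lambda^{\neq 0}$ with $d(\lambda)=d(\mu)$; 4. $v=\sum_{\lambda\in v\Lambda^n}\lambda\lambda^*$ for $v\in\Lambda^0$ and $n\in\mathbb{N}^k\setminus\{0\}$. For $v\in\mathbb{Z}^k$ and $n\in\mathbb{N}^k\setminus\{0\}$ put $\lambda^{v,n}=(v,v-n,(1,\dots,1))$. Let $\mathcal{A}$ be the set of all pairs $(\lambda,\mu)$ with $\lambda,\mu\in\Lambda^{\neq 0}$ and $s(\lambda)=s(\mu)$ for which there are no $n\in\mathbb{N}^k\setminus\{0\}$ and $\lambda',\mu'\in\Lambda$ with $\lambda=\lambda'\circ\lambda^{s(\lambda'),n}$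 and $\mu=\mu'\circ\lambda^{s(\mu'),n}$. For $(\lambda,\mu),(\lambda',\mu')\in\mathcal{A}$ write $(\lambda,\mu)\sim(\lambda',\mu')$ if there are $m,n\in\mathbb{N}^k\setminus\{0\}$ with $\lambda\circ\lambda^{s(\lambda),m}=\lambda'\circ\lambda^{s(\lambda'),n}$ and $\mu\circ\lambda^{s(\mu),m}=\mu'\circ\lambda^{s(\mu'),n}$; this is an equivalence relation on $\mathcal{A}$. Let $\mathcal{R}\subseteq\mathcal{A}$ be any set that contains exactly one element of each equivalence class. Then the family consisting of the elements $v$ $(v\in\Lambda^0)$, $\lambda$ $(\lambda\in\Lambda^{\neq0})$, $\lambda^*$ $(\lambda\in\Lambda^{\neq0})$ and $\lambda\mu^*$ $((\lambda,\mu)\in\mathcal{R})$ is a basis of the $R$-module $KP_R(\Lambda)$. -/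

import Mathlib

universe u

/-- A `k`-graph: a countable small category, presented by its set `Vertex` of objects, its set `Path`
of morphisms, its codomain map `r` and domain map `s`, the identities and the composition
(`comp a b` is the morphism `a ∘ b`, defined when `s a = r b`), with a degree functor `d` to `ℕ^k`
that has the factorization property. -/
structure KGraph (k : ℕ) where
  Vertex : Type u
  Path : Type u
  countable_path : Countable Path
  r : Path → Vertex
  s : Path → Vertex
  ident : Vertex → Path
  comp : (a b : Path) → s a = r b → Path
  r_ident : ∀ v, r (ident v) = v
  s_ident : ∀ v, s (ident v) = v
  r_comp : ∀ a b h, r (comp a b h) = r a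
  s_comp : ∀ a b h, s (comp a b h) = s b
  ident_comp : ∀ a, comp (ident (r a)) a (s_ident (r a)) = a
  comp_ident : ∀ a, comp a (ident (s a)) (r_ident (s a)).symm = a
  comp_assoc : ∀ a b c (h₁ : s a = r b) (h₂ : s b = r c),
    comp (comp a b h₁) c ((s_comp a b h₁).trans h₂) =
      comp a (comp b c h₂) (h₁.trans (r_comp b c h₂).symm)
  d : Path → (Fin k → ℕ)
  d_ident : ∀ v, d (ident v) = 0
  d_comp : ∀ a b h, d (comp a b h) = d a + d b
  factorization : ∀ (a : Path) (m n : Fin k → ℕ), d a = m + n →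
    ∃! bc : Path × Path, d bc.1 = m ∧ d bc.2 = n ∧ ∃ h : s bc.1 = r bc.2, a = comp bc.1 bc.2 h

namespace KGraph

variable {k : ℕ} (Λ : KGraph.{u} k)

/-- Every `v Λ^n` is finite. -/
class RowFinite : Prop where
  finite : ∀ (v : Λ.Vertex) (n : Fin k → ℕ), {a : Λ.Path | Λ.r a = v ∧ Λ.d a = n}.Finite

/-- Every `v Λ^n` is nonempty. -/
class NoSources : Prop where
  nonempty : ∀ (v : Λ.Vertex) (n : Fin k → ℕ), {a : Λ.Path | Λ.r a = v ∧ Λ.d a = n}.Nonempty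

/-- The paths of nonzero degree. -/
abbrev NonzeroPath : Type u := {a : Λ.Path // Λ.d a ≠ 0}

variable {Λ} in
/-- The composition of two paths of nonzero degree. -/
def NonzeroPath.comp (a b : Λ.NonzeroPath) (h : Λ.s a.1 = Λ.r b.1) : Λ.NonzeroPath :=
  ⟨Λ.comp a.1 b.1 h, fun h0 => a.2 (by
    rw [Λ.d_comp] at h0
    exact (add_eq_zero.mp h0).1)⟩

/-- The set of generators: vertices, paths of nonzero degree and their ghost paths. -/
inductive Gen : Type u
  | vertex (v : Λ.Vertex)
  | path (a : Λ.NonzeroPath)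
  | ghost (a : Λ.NonzeroPath)

variable (R : Type*) [CommRing R]

/-- The free associative, not necessarily unital, `R`-algebra on the generators: the semigroup
algebra of the free semigroup (of nonempty words). -/
abbrev FreeAlg := MonoidAlgebra R (FreeSemigroup Λ.Gen)

variable {Λ} in
/-- A generator as an element of the free algebra. -/
noncomputable def FreeAlg.of (x : Λ.Gen) : Λ.FreeAlg R :=
  MonoidAlgebra.single (FreeSemigroup.of x) 1

variable {Λ} in
/-- The elements of `v Λ^n` of nonzero degree (all of `v Λ^n` if `n ≠ 0`). -/
noncomputable def pathsOfDegree [Λ.RowFinite] (v : Λ.Vertex) (n : Fin k → ℕ) :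
    Finset Λ.NonzeroPath :=
  ((RowFinite.finite v n).preimage (f := fun a : Λ.NonzeroPath => a.1)
    Subtype.val_injective.injOn).toFinset

open FreeAlg Gen in
/-- The relations (KP1)--(KP4), each written as `lhs ~ rhs`. -/
inductive KPRel [Λ.RowFinite] : Λ.FreeAlg R → Λ.FreeAlg R → Prop
  | vertex_idem (v : Λ.Vertex) : KPRel (of R (vertex v) * of R (vertex v)) (of R (vertex v))
  | vertex_orth (v w : Λ.Vertex) (h : v ≠ w) : KPRel (of R (vertex v) * of R (vertex w)) 0
  | path_mul (a b : Λ.NonzeroPath) (h : Λ.s a.1 = Λ.r b.1) :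
      KPRel (of R (path a) * of R (path b)) (of R (path (a.comp b h)))
  | ghost_mul (a b : Λ.NonzeroPath) (h : Λ.s a.1 = Λ.r b.1) :
      KPRel (of R (ghost b) * of R (ghost a)) (of R (ghost (a.comp b h)))
  | r_mul_path (a : Λ.NonzeroPath) :
      KPRel (of R (vertex (Λ.r a.1)) * of R (path a)) (of R (path a))
  | path_mul_s (a : Λ.NonzeroPath) :
      KPRel (of R (path a) * of R (vertex (Λ.s a.1))) (of R (path a))
  | s_mul_ghost (a : Λ.NonzeroPath) :
      KPRel (of R (vertex (Λ.s a.1)) * of R (ghost a)) (of R (ghost a))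
  | ghost_mul_r (a : Λ.NonzeroPath) :
      KPRel (of R (ghost a) * of R (vertex (Λ.r a.1))) (of R (ghost a))
  | ghost_mul_path_self (a : Λ.NonzeroPath) :
      KPRel (of R (ghost a) * of R (path a)) (of R (vertex (Λ.s a.1)))
  | ghost_mul_path_ne (a b : Λ.NonzeroPath) (hd : Λ.d a.1 = Λ.d b.1) (h : a ≠ b) :
      KPRel (of R (ghost a) * of R (path b)) 0
  | vertex_eq_sum (v : Λ.Vertex) (n : Fin k → ℕ) (hn : n ≠ 0) :
      KPRel (of R (vertex v)) (∑ a ∈ pathsOfDegree v n, of R (path a) * of R (ghost a))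

/-- The `R`-algebra congruence generated by (KP1)--(KP4). As the free algebra has no unit, closure
under scalar multiplication has to be asked for separately, which is done by passing to all scalar
multiples of the relations. -/
noncomputable def kpCon [Λ.RowFinite] : RingCon (Λ.FreeAlg R) :=
  ringConGen fun x y => ∃ (c : R) (x₀ y₀ : Λ.FreeAlg R),
    Λ.KPRel R x₀ y₀ ∧ x = c • x₀ ∧ y = c • y₀

theorem kpCon_smul [Λ.RowFinite] (c : R) {x y : Λ.FreeAlg R} (h : Λ.kpCon R x y) :
    Λ.kpCon R (c • x) (c • y) := by
  change RingConGen.Rel _ _ _ at h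
  change RingConGen.Rel _ _ _
  induction h with
  | of x y h =>
    obtain ⟨e, x₀, y₀, h, rfl, rfl⟩ := h
    exact .of _ _ ⟨c * e, x₀, y₀, h, by rw [mul_smul], by rw [mul_smul]⟩
  | refl x => exact .refl _
  | symm _ ih => exact .symm ih
  | trans _ _ ih₁ ih₂ => exact .trans ih₁ ih₂
  | add _ _ ih₁ ih₂ =>
    rw [smul_add, smul_add]
    exact .add ih₁ ih₂
  | mul _ h₂ ih₁ _ =>
    rw [← smul_mul_assoc, ← smul_mul_assoc]
    exact .mul ih₁ h₂

/-- The Kumjian--Pask algebra of a row-finite `k`-graph. -/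
noncomputable def KP [Λ.RowFinite] := (Λ.kpCon R).Quotient

namespace KP

variable [Λ.RowFinite]

noncomputable instance : NonUnitalRing (Λ.KP R) :=
  inferInstanceAs (NonUnitalRing (Λ.kpCon R).Quotient)

/-- The class of an element of the free algebra. -/
noncomputable def mk (x : Λ.FreeAlg R) : Λ.KP R := RingCon.toQuotient (c := Λ.kpCon R) x

theorem mk_surjective : Function.Surjective (mk Λ R) := Quotient.mk''_surjective

/-- `mk` as an additive map. -/
noncomputable def mkHom : Λ.FreeAlg R →+ Λ.KP R where
  toFun := mk Λ R
  map_zero' := rfl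
  map_add' _ _ := rfl

noncomputable instance : SMul R (Λ.KP R) :=
  ⟨fun c => Quotient.map' (c • ·) fun _ _ h => kpCon_smul Λ R c h⟩

noncomputable instance : Module R (Λ.KP R) :=
  Function.Surjective.module R (mkHom Λ R) (mk_surjective Λ R) fun _ _ => rfl

instance : IsScalarTower R (Λ.KP R) (Λ.KP R) where
  smul_assoc c x y := by
    obtain ⟨x, rfl⟩ := mk_surjective Λ R x
    obtain ⟨y, rfl⟩ := mk_surjective Λ R y
    exact congrArg (mk Λ R) (smul_mul_assoc c x y)

instance : SMulCommClass R (Λ.KP R) (Λ.KP R) where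
  smul_comm c x y := by
    obtain ⟨x, rfl⟩ := mk_surjective Λ R x
    obtain ⟨y, rfl⟩ := mk_surjective Λ R y
    exact congrArg (mk Λ R) (mul_smul_comm c x y).symm

variable {Λ}

/-- The vertex `v` in the Kumjian--Pask algebra. -/
noncomputable def vertex (v : Λ.Vertex) : Λ.KP R := mk Λ R (FreeAlg.of R (.vertex v))

/-- The path `a` in the Kumjian--Pask algebra. -/
noncomputable def path (a : Λ.NonzeroPath) : Λ.KP R := mk Λ R (FreeAlg.of R (.path a))

/-- The ghost path `a*` in the Kumjian--Pask algebra. -/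
noncomputable def ghost (a : Λ.NonzeroPath) : Λ.KP R := mk Λ R (FreeAlg.of R (.ghost a))

end KP

end KGraph

/-- The paths `(v, w, p)` of the standard `k`-graph of level `l`: `v ≥ w` in `ℤ^k`, and `p` is a tuple
of `|v - w|` levels. The levels `1, …, l` are represented by the elements `0, …, l - 1` of `Fin l`. -/
@[ext]
structure StdPath (k l : ℕ) where
  rng : Fin k → ℤ
  src : Fin k → ℤ
  lv : List (Fin l)
  le : src ≤ rng
  length_lv : (lv.length : ℤ) = ∑ i, (rng i - src i)

namespace StdPath

variable {k l : ℕ}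

/-- `(u, v, p) ∘ (v, w, q) = (u, w, p × q)`. -/
def comp (a b : StdPath k l) (h : a.src = b.rng) : StdPath k l where
  rng := a.rng
  src := b.src
  lv := a.lv ++ b.lv
  le := b.le.trans (h ▸ a.le)
  length_lv := by
    rw [List.length_append, Nat.cast_add, a.length_lv, b.length_lv, h, ← Finset.sum_add_distrib]
    exact Finset.sum_congr rfl fun i _ => by ring

/-- `d(v, w, p) = v - w`. -/
def deg (a : StdPath k l) : Fin k → ℕ := fun i => (a.rng i - a.src i).toNat

theorem deg_cast (a : StdPath k l) (i : Fin k) : (a.deg i : ℤ) = a.rng i - a.src i :=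
  Int.toNat_of_nonneg (sub_nonneg.mpr (a.le i))

theorem length_eq (a : StdPath k l) : a.lv.length = ∑ i, a.deg i := by
  have h := a.length_lv
  simp only [← deg_cast] at h
  exact_mod_cast h

theorem src_eq (a : StdPath k l) : a.src = fun i => a.rng i - a.deg i := by
  funext i
  rw [deg_cast]
  ring

theorem ext_deg {a b : StdPath k l} (hr : a.rng = b.rng) (hd : a.deg = b.deg)
    (hl : a.lv = b.lv) : a = b :=
  StdPath.ext hr (by rw [src_eq a, src_eq b, hr, hd]) hl

/-- The path `(v, v - n, p)`. -/
def ofDeg (v : Fin k → ℤ) (n : Fin k → ℕ) (p : List (Fin l)) (hp : p.length = ∑ i, n i) :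
    StdPath k l where
  rng := v
  src := fun i => v i - n i
  lv := p
  le := fun i => by simp
  length_lv := by simp [hp]

theorem deg_ofDeg (v : Fin k → ℤ) (n : Fin k → ℕ) (p : List (Fin l)) (hp : p.length = ∑ i, n i) :
    (ofDeg v n p hp).deg = n := by
  funext i
  simp [deg, ofDeg]

theorem deg_comp (a b : StdPath k l) (h : a.src = b.rng) :
    (a.comp b h).deg = a.deg + b.deg := by
  funext i
  have h1 := deg_cast (a.comp b h) i
  have h2 := deg_cast a i
  have h3 := deg_cast b i
  have h4 := congrFun h i
  simp only [comp] at h1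
  simp only [Pi.add_apply]
  simp only [comp]
  omega

instance : Countable (StdPath k l) :=
  Function.Injective.countable (f := fun a : StdPath k l => (a.rng, a.src, a.lv)) fun a b h => by
    simp only [Prod.mk.injEq] at h
    exact StdPath.ext h.1 h.2.1 h.2.2

theorem factorization (a : StdPath k l) (m n : Fin k → ℕ) (h : a.deg = m + n) :
    ∃! bc : StdPath k l × StdPath k l, bc.1.deg = m ∧ bc.2.deg = n ∧
      ∃ h : bc.1.src = bc.2.rng, a = bc.1.comp bc.2 h := by
  have hlen : a.lv.length = ∑ i, m i + ∑ i, n i := by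
    rw [length_eq, h, ← Finset.sum_add_distrib]
    rfl
  have h1 : (a.lv.take (∑ i, m i)).length = ∑ i, m i := by simp [hlen]
  have h2 : (a.lv.drop (∑ i, m i)).length = ∑ i, n i := by simp [hlen]
  refine ⟨(ofDeg a.rng m (a.lv.take (∑ i, m i)) h1,
    ofDeg (fun i => a.rng i - m i) n (a.lv.drop (∑ i, m i)) h2),
    ⟨deg_ofDeg _ _ _ h1, deg_ofDeg _ _ _ h2, rfl, ?_⟩, ?_⟩
  · refine ext_deg rfl ?_ ?_
    · refine Eq.trans ?_ (deg_comp (ofDeg _ _ _ h1) (ofDeg _ _ _ h2) rfl).symm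
      rw [deg_ofDeg, deg_ofDeg, h]
    · simp [comp, ofDeg]
  · rintro ⟨b, c⟩ ⟨hb, hc, hbc, rfl⟩
    simp only at hb hc hbc
    have hlb : b.lv.length = ∑ i, m i := by rw [length_eq, hb]
    refine Prod.ext (ext_deg rfl ?_ ?_) (ext_deg ?_ ?_ ?_)
    · rw [deg_ofDeg, hb]
    · simp [comp, ofDeg, ← hlb]
    · simp only [ofDeg, comp]
      rw [← hbc, src_eq b, hb]
    · rw [deg_ofDeg, hc]
    · simp [comp, ofDeg, ← hlb]

end StdPath

/-- The standard `k`-graph of level `l`. -/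
abbrev stdKGraph (k l : ℕ) : KGraph.{0} k where
  Vertex := Fin k → ℤ
  Path := StdPath k l
  countable_path := inferInstance
  r := StdPath.rng
  s := StdPath.src
  ident v := ⟨v, v, [], le_rfl, by simp⟩
  comp := StdPath.comp
  r_ident _ := rfl
  s_ident _ := rfl
  r_comp _ _ _ := rfl
  s_comp _ _ _ := rfl
  ident_comp _ := StdPath.ext rfl rfl rfl
  comp_ident _ := StdPath.ext rfl rfl (List.append_nil _)
  comp_assoc _ _ _ _ _ := StdPath.ext rfl rfl (List.append_assoc _ _ _)
  d := StdPath.deg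
  d_ident _ := by funext i; simp [StdPath.deg]
  d_comp := StdPath.deg_comp
  factorization := StdPath.factorization

instance (k l : ℕ) : (stdKGraph k l).RowFinite where
  finite v n := by
    refine Set.Finite.of_finite_image (f := StdPath.lv)
      ((List.finite_length_eq (Fin l) (∑ i, n i)).subset ?_) ?_
    · rintro _ ⟨a, ⟨_, hd⟩, rfl⟩
      exact (StdPath.length_eq a).trans (congrArg (fun d : Fin k → ℕ => ∑ i, d i) hd)
    · rintro a ⟨ha, hda⟩ b ⟨hb, hdb⟩ hab
      exact StdPath.ext_deg (ha.trans hb.symm) (hda.trans hdb.symm) hab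

namespace StdPath

variable {k l : ℕ} [NeZero l]

/-- The path `λ^{v,n} = (v, v - n, (1, …, 1))`; the level `1` is the element `0` of `Fin l`. -/
def allOnes (v : Fin k → ℤ) (n : Fin k → ℕ) : StdPath k l :=
  ofDeg v n (List.replicate (∑ i, n i) 0) (by simp)

/-- The path `a ∘ λ^{s(a),n}`. -/
def extendOnes (a : StdPath k l) (n : Fin k → ℕ) : StdPath k l :=
  a.comp (allOnes a.src n) rfl

end StdPath

instance (k l : ℕ) [NeZero l] : (stdKGraph k l).NoSources where
  nonempty v n := ⟨StdPath.allOnes v n, rfl, StdPath.deg_ofDeg ..⟩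

/-- The paths of nonzero degree in the standard `k`-graph of level `l`. -/
abbrev StdNonzeroPath (k l : ℕ) : Type := (stdKGraph k l).NonzeroPath

/-- The set `Â` of pairs of paths of nonzero degree with common source. -/
def pairsHat (k l : ℕ) : Set (StdNonzeroPath k l × StdNonzeroPath k l) :=
  {x | (stdKGraph k l).s x.1.1 = (stdKGraph k l).s x.2.1}

/-- The set `A` of the pairs in `Â` that have no common tail `λ^{∼,n}` with `n ≠ 0`. -/
def pairsA (k l : ℕ) [NeZero l] : Set (StdNonzeroPath k l × StdNonzeroPath k l) :=
  {x | x ∈ pairsHat k l ∧ ¬ ∃ (n : Fin k → ℕ) (a b : StdPath k l),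
    n ≠ 0 ∧ x.1.1 = a.extendOnes n ∧ x.2.1 = b.extendOnes n}

/-- The equivalence relation `∼` (used on the pairs in `A` only). -/
def PairEquiv {k l : ℕ} [NeZero l] (x y : StdNonzeroPath k l × StdNonzeroPath k l) : Prop :=
  ∃ m n : Fin k → ℕ, m ≠ 0 ∧ n ≠ 0 ∧
    StdPath.extendOnes x.1.1 m = StdPath.extendOnes y.1.1 n ∧
    StdPath.extendOnes x.2.1 m = StdPath.extendOnes y.2.1 n

/-- `𝓡` consists of exactly one representative of each equivalence class of `∼` on `A`. -/
def IsRepresentativeSet {k l : ℕ} [NeZero l]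
    (𝓡 : Set (StdNonzeroPath k l × StdNonzeroPath k l)) : Prop :=
  𝓡 ⊆ pairsA k l ∧ ∀ x ∈ pairsA k l, ∃! y, y ∈ 𝓡 ∧ PairEquiv x y

/-! Spanning. Products `a b*` with common source, degree zero allowed, span the algebra, because
their span contains the generators and is stable under left multiplication by them
(`spanPairs_eq_top`). If `a = a' x` and `b = b' x` end in a common edge `x` of level 1, the relation
(KP4) in the degree of `x` writes `a b*` as `a' b'*` minus terms ending in a common edge of another
level. Those terms have no common tail, so induction on length leaves only pairs without common tail
(`pathOf_mul_ghostOf_mem_of_noCommonTail`). Among these, `a b*` depends only on the two ranges and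
the two level words: two admissible sources have equal coordinate sum, and expanding down to a
common lower vertex gives the same terms (`pathOf_mul_ghostOf_congr`). Hence one representative per
class suffices.

Independence. Append infinitely many 1s to the level word of each path. Extension by 1s preserves
the ranges and these infinite words, and for pairs without common tail they determine the finite
words (`lv_eq_of_word_eq`). The algebra acts on functions of infinite words with a base vertex: `a
b*` tests for the prefix `a` and replaces it by `b`. Evaluating this action on indicator functions
gives functionals that are unitriangular against the proposed basis, ranked by the point from which
the word of `a` is constantly 1 (`linearIndependent_pathOf_mul_ghostOf`). -/

namespace KGraph

variable {k : ℕ} {Λ : KGraph.{u} k}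

/-- A path of degree zero is an identity. -/
theorem eq_ident_of_d_eq_zero {a : Λ.Path} (h : Λ.d a = 0) : a = Λ.ident (Λ.r a) := by
  obtain ⟨x, -, hx⟩ := Λ.factorization a 0 0 (by simp [h])
  -- In degree `0 + 0` both `(r(a), a)` and `(a, s(a))` factor `a`; uniqueness identifies their
  -- first entries.
  have h1 := hx (Λ.ident (Λ.r a), a) ⟨Λ.d_ident _, h, Λ.s_ident _, (Λ.ident_comp a).symm⟩
  have h2 := hx (a, Λ.ident (Λ.s a)) ⟨h, Λ.d_ident _, (Λ.r_ident _).symm, (Λ.comp_ident a).symm⟩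
  exact congrArg Prod.fst (h2.trans h1.symm)

theorem s_eq_r_of_d_eq_zero {a : Λ.Path} (h : Λ.d a = 0) : Λ.s a = Λ.r a := by
  conv_lhs => rw [eq_ident_of_d_eq_zero h]
  exact Λ.s_ident _

theorem comp_eq_right {a b : Λ.Path} (h : Λ.s a = Λ.r b) (ha : Λ.d a = 0) :
    Λ.comp a b h = b := by
  have h1 : a = Λ.ident (Λ.r b) := by
    rw [eq_ident_of_d_eq_zero ha, ← s_eq_r_of_d_eq_zero ha, h]
  subst h1
  exact Λ.ident_comp b

theorem comp_eq_left {a b : Λ.Path} (h : Λ.s a = Λ.r b) (hb : Λ.d b = 0) :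
    Λ.comp a b h = a := by
  have h1 : b = Λ.ident (Λ.s a) := by rw [eq_ident_of_d_eq_zero hb, h]
  subst h1
  exact Λ.comp_ident a

theorem mem_pathsOfDegree [Λ.RowFinite] {v : Λ.Vertex} {n : Fin k → ℕ} {a : Λ.NonzeroPath} :
    a ∈ pathsOfDegree v n ↔ Λ.r a.1 = v ∧ Λ.d a.1 = n := by
  simp [pathsOfDegree]

/-! ### Kumjian–Pask relations with vertices read as paths of degree zero -/

namespace KP

variable [Λ.RowFinite] (R : Type*) [CommRing R]

theorem mk_eq_mk {x y : Λ.FreeAlg R} (h : Λ.KPRel R x y) : mk Λ R x = mk Λ R y :=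
  Quotient.sound (RingConGen.Rel.of _ _ ⟨1, x, y, h, by simp, by simp⟩)

theorem mk_mul (x y : Λ.FreeAlg R) : mk Λ R (x * y) = mk Λ R x * mk Λ R y := rfl

theorem mk_smul (c : R) (x : Λ.FreeAlg R) : mk Λ R (c • x) = c • mk Λ R x := rfl

theorem vertex_mul_self (v : Λ.Vertex) : vertex R v * vertex R v = vertex R v :=
  mk_eq_mk R (.vertex_idem v)

theorem vertex_mul_of_ne {v w : Λ.Vertex} (h : v ≠ w) : vertex R v * vertex R w = 0 :=
  mk_eq_mk R (.vertex_orth v w h)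

theorem path_mul_path (a b : Λ.NonzeroPath) (h : Λ.s a.1 = Λ.r b.1) :
    path R a * path R b = path R (a.comp b h) := mk_eq_mk R (.path_mul a b h)

theorem ghost_mul_ghost (a b : Λ.NonzeroPath) (h : Λ.s a.1 = Λ.r b.1) :
    ghost R b * ghost R a = ghost R (a.comp b h) := mk_eq_mk R (.ghost_mul a b h)

theorem vertex_mul_path (a : Λ.NonzeroPath) : vertex R (Λ.r a.1) * path R a = path R a :=
  mk_eq_mk R (.r_mul_path a)

theorem path_mul_vertex (a : Λ.NonzeroPath) : path R a * vertex R (Λ.s a.1) = path R a :=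
  mk_eq_mk R (.path_mul_s a)

theorem vertex_mul_ghost (a : Λ.NonzeroPath) : vertex R (Λ.s a.1) * ghost R a = ghost R a :=
  mk_eq_mk R (.s_mul_ghost a)

theorem ghost_mul_vertex (a : Λ.NonzeroPath) : ghost R a * vertex R (Λ.r a.1) = ghost R a :=
  mk_eq_mk R (.ghost_mul_r a)

theorem ghost_mul_path_self (a : Λ.NonzeroPath) : ghost R a * path R a = vertex R (Λ.s a.1) :=
  mk_eq_mk R (.ghost_mul_path_self a)

theorem ghost_mul_path_of_ne {a b : Λ.NonzeroPath} (hd : Λ.d a.1 = Λ.d b.1) (h : a ≠ b) :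
    ghost R a * path R b = 0 := mk_eq_mk R (.ghost_mul_path_ne a b hd h)

theorem vertex_eq_sum (v : Λ.Vertex) {n : Fin k → ℕ} (hn : n ≠ 0) :
    vertex R v = ∑ a ∈ pathsOfDegree v n, path R a * ghost R a :=
  (mk_eq_mk R (.vertex_eq_sum v n hn)).trans (map_sum (mkHom Λ R) _ _)

open Classical in
/-- The class of an arbitrary path, where a path of degree zero is read as a vertex. -/
noncomputable def pathOf (a : Λ.Path) : Λ.KP R :=
  if h : Λ.d a = 0 then vertex R (Λ.r a) else path R ⟨a, h⟩

open Classical in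
/-- The class of the ghost of an arbitrary path, where a path of degree zero is read as a vertex. -/
noncomputable def ghostOf (a : Λ.Path) : Λ.KP R :=
  if h : Λ.d a = 0 then vertex R (Λ.r a) else ghost R ⟨a, h⟩

theorem pathOf_of_eq_zero {a : Λ.Path} (h : Λ.d a = 0) : pathOf R a = vertex R (Λ.r a) :=
  dif_pos h

theorem ghostOf_of_eq_zero {a : Λ.Path} (h : Λ.d a = 0) : ghostOf R a = vertex R (Λ.r a) :=
  dif_pos h

theorem pathOf_coe (a : Λ.NonzeroPath) : pathOf R a.1 = path R a := dif_neg a.2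

theorem ghostOf_coe (a : Λ.NonzeroPath) : ghostOf R a.1 = ghost R a := dif_neg a.2

theorem vertex_mul_pathOf (a : Λ.Path) : vertex R (Λ.r a) * pathOf R a = pathOf R a := by
  by_cases h : Λ.d a = 0
  · rw [pathOf_of_eq_zero R h, vertex_mul_self]
  · exact (pathOf_coe R ⟨a, h⟩).symm ▸ vertex_mul_path R ⟨a, h⟩

theorem pathOf_mul_vertex (a : Λ.Path) : pathOf R a * vertex R (Λ.s a) = pathOf R a := by
  by_cases h : Λ.d a = 0
  · rw [pathOf_of_eq_zero R h, s_eq_r_of_d_eq_zero h, vertex_mul_self]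
  · exact (pathOf_coe R ⟨a, h⟩).symm ▸ path_mul_vertex R ⟨a, h⟩

theorem vertex_mul_ghostOf (a : Λ.Path) : vertex R (Λ.s a) * ghostOf R a = ghostOf R a := by
  by_cases h : Λ.d a = 0
  · rw [ghostOf_of_eq_zero R h, s_eq_r_of_d_eq_zero h, vertex_mul_self]
  · exact (ghostOf_coe R ⟨a, h⟩).symm ▸ vertex_mul_ghost R ⟨a, h⟩

theorem ghostOf_mul_vertex (a : Λ.Path) : ghostOf R a * vertex R (Λ.r a) = ghostOf R a := by
  by_cases h : Λ.d a = 0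
  · rw [ghostOf_of_eq_zero R h, vertex_mul_self]
  · exact (ghostOf_coe R ⟨a, h⟩).symm ▸ ghost_mul_vertex R ⟨a, h⟩

theorem pathOf_mul_pathOf {a b : Λ.Path} (h : Λ.s a = Λ.r b) :
    pathOf R a * pathOf R b = pathOf R (Λ.comp a b h) := by
  by_cases ha : Λ.d a = 0
  · rw [pathOf_of_eq_zero R ha, ← s_eq_r_of_d_eq_zero ha, h, vertex_mul_pathOf,
      comp_eq_right h ha]
  by_cases hb : Λ.d b = 0
  · rw [pathOf_of_eq_zero R hb, ← h, pathOf_mul_vertex, comp_eq_left h hb]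
  have := path_mul_path R ⟨a, ha⟩ ⟨b, hb⟩ h
  rwa [← pathOf_coe, ← pathOf_coe, ← pathOf_coe] at this

theorem ghostOf_mul_ghostOf {a b : Λ.Path} (h : Λ.s a = Λ.r b) :
    ghostOf R b * ghostOf R a = ghostOf R (Λ.comp a b h) := by
  by_cases ha : Λ.d a = 0
  · rw [ghostOf_of_eq_zero R ha, ← s_eq_r_of_d_eq_zero ha, h, ghostOf_mul_vertex,
      comp_eq_right h ha]
  by_cases hb : Λ.d b = 0
  · rw [ghostOf_of_eq_zero R hb, ← h, vertex_mul_ghostOf, comp_eq_left h hb]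
  have := ghost_mul_ghost R ⟨a, ha⟩ ⟨b, hb⟩ h
  rwa [← ghostOf_coe, ← ghostOf_coe, ← ghostOf_coe] at this

theorem vertex_mul_pathOf_of_ne {v : Λ.Vertex} {a : Λ.Path} (h : v ≠ Λ.r a) :
    vertex R v * pathOf R a = 0 := by
  rw [← vertex_mul_pathOf, ← mul_assoc, vertex_mul_of_ne R h, zero_mul]

theorem pathOf_mul_pathOf_of_ne {a b : Λ.Path} (h : Λ.s a ≠ Λ.r b) :
    pathOf R a * pathOf R b = 0 := by
  rw [← pathOf_mul_vertex, mul_assoc, vertex_mul_pathOf_of_ne R h, mul_zero]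

/-- The Cuntz--Krieger expansion of `a b*`. -/
theorem pathOf_mul_ghostOf_eq_sum {a b : Λ.Path} (h : Λ.s a = Λ.s b) {n : Fin k → ℕ}
    (hn : n ≠ 0) :
    pathOf R a * ghostOf R b =
      ∑ c ∈ pathsOfDegree (Λ.s a) n,
        (pathOf R a * pathOf R c.1) * (ghostOf R c.1 * ghostOf R b) := by
  conv_lhs =>
    rw [← vertex_mul_ghostOf R b, ← h, vertex_eq_sum R (Λ.s a) hn, Finset.sum_mul,
      Finset.mul_sum]
  refine Finset.sum_congr rfl fun c _ => ?_
  rw [pathOf_coe, ghostOf_coe]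
  simp only [mul_assoc]

/-! ### Spanning by the products `a b*` -/

variable (Λ) in
/-- The span of the elements `a b*`, where `a` and `b` may have degree zero. -/
noncomputable def spanPairs : Submodule R (Λ.KP R) :=
  Submodule.span R {x | ∃ a b : Λ.Path, Λ.s a = Λ.s b ∧ x = pathOf R a * ghostOf R b}

theorem pathOf_mul_ghostOf_mem {a b : Λ.Path} (h : Λ.s a = Λ.s b) :
    pathOf R a * ghostOf R b ∈ spanPairs Λ R := Submodule.subset_span ⟨a, b, h, rfl⟩

/-- Once `a` is at least as long as `c` in every direction, the initial segment of `a` of degree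
`d(c)` either equals `c` and cancels, or is killed by (KP3). -/
theorem ghost_mul_pathOf_mul_ghostOf_mem (c : Λ.NonzeroPath) {a b : Λ.Path}
    (h : Λ.s a = Λ.s b) (hle : Λ.d c.1 ≤ Λ.d a) :
    ghost R c * (pathOf R a * ghostOf R b) ∈ spanPairs Λ R := by
  obtain ⟨⟨a₁, a₂⟩, ⟨h₁, -, hs, rfl⟩, -⟩ :=
    Λ.factorization a (Λ.d c.1) (Λ.d a - Λ.d c.1) (add_tsub_cancel_of_le hle).symm
  simp only at h₁ hs h
  have h₁' : Λ.d a₁ ≠ 0 := h₁ ▸ c.2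
  rw [← pathOf_mul_pathOf, ← mul_assoc, ← mul_assoc, pathOf_coe R ⟨a₁, h₁'⟩]
  by_cases hc : c = ⟨a₁, h₁'⟩
  · rw [hc, ghost_mul_path_self, hs, vertex_mul_pathOf]
    exact pathOf_mul_ghostOf_mem R ((Λ.s_comp _ _ _).symm.trans h)
  · rw [ghost_mul_path_of_ne R h₁.symm hc, zero_mul, zero_mul]
    exact zero_mem _

theorem gen_mul_mem_spanPairs (g : Λ.Gen) {x : Λ.KP R} (hx : x ∈ spanPairs Λ R) :
    mk Λ R (FreeAlg.of R g) * x ∈ spanPairs Λ R := by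
  induction hx using Submodule.span_induction with
  | zero => rw [mul_zero]; exact zero_mem _
  | add x y _ _ hx hy => rw [mul_add]; exact add_mem hx hy
  | smul c x _ hx => rw [mul_smul_comm]; exact Submodule.smul_mem _ _ hx
  | mem x hx =>
    obtain ⟨a, b, h, rfl⟩ := hx
    cases g with
    | vertex v =>
      change vertex R v * _ ∈ _
      rw [← mul_assoc]
      by_cases hv : v = Λ.r a
      · rw [hv, vertex_mul_pathOf]
        exact pathOf_mul_ghostOf_mem R h
      · rw [vertex_mul_pathOf_of_ne R hv, zero_mul]
        exact zero_mem _
    | path c =>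
      change path R c * _ ∈ _
      rw [← mul_assoc, ← pathOf_coe]
      by_cases hv : Λ.s c.1 = Λ.r a
      · rw [pathOf_mul_pathOf R hv]
        exact pathOf_mul_ghostOf_mem R ((Λ.s_comp _ _ _).trans h)
      · rw [pathOf_mul_pathOf_of_ne R hv, zero_mul]
        exact zero_mem _
    | ghost c =>
      change ghost R c * _ ∈ _
      -- Expanding in degree `d(c)` makes the left factor of every term long enough to meet `c*`.
      rw [pathOf_mul_ghostOf_eq_sum R h c.2, Finset.mul_sum]
      refine sum_mem fun e he => ?_
      obtain ⟨hr, hd⟩ := mem_pathsOfDegree.mp he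
      rw [pathOf_mul_pathOf R hr.symm, ghostOf_mul_ghostOf R (h.symm.trans hr.symm)]
      refine ghost_mul_pathOf_mul_ghostOf_mem R c (by rw [Λ.s_comp, Λ.s_comp]) ?_
      rw [Λ.d_comp, hd]
      exact le_add_self

theorem gen_mem_spanPairs (g : Λ.Gen) : mk Λ R (FreeAlg.of R g) ∈ spanPairs Λ R := by
  cases g with
  | vertex v =>
    have h := pathOf_mul_ghostOf_mem R (a := Λ.ident v) (b := Λ.ident v) rfl
    rwa [pathOf_of_eq_zero R (Λ.d_ident v), ghostOf_of_eq_zero R (Λ.d_ident v), Λ.r_ident,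
      vertex_mul_self] at h
  | path c =>
    have h := pathOf_mul_ghostOf_mem R (a := c.1) (b := Λ.ident (Λ.s c.1)) (Λ.s_ident _).symm
    rwa [pathOf_coe, ghostOf_of_eq_zero R (Λ.d_ident _), Λ.r_ident, path_mul_vertex] at h
  | ghost c =>
    have h := pathOf_mul_ghostOf_mem R (a := Λ.ident (Λ.s c.1)) (b := c.1) (Λ.s_ident _)
    rwa [ghostOf_coe, pathOf_of_eq_zero R (Λ.d_ident _), Λ.r_ident, vertex_mul_ghost] at h

/-- Stability under left multiplication alone is enough, since every word is built from a generator
by prepending further generators. -/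
theorem spanPairs_eq_top : spanPairs Λ R = ⊤ := by
  refine eq_top_iff.mpr fun x hx => ?_
  clear hx
  obtain ⟨x, rfl⟩ := mk_surjective Λ R x
  have key : ∀ w : FreeSemigroup Λ.Gen,
      mk Λ R (MonoidAlgebra.single w 1) ∈ spanPairs Λ R := by
    intro w
    induction w using FreeSemigroup.recOnMul with
    | ih1 g => exact gen_mem_spanPairs R g
    | ih2 g w _ ih =>
      have : (MonoidAlgebra.single (FreeSemigroup.of g * w) 1 : Λ.FreeAlg R) =
          FreeAlg.of R g * MonoidAlgebra.single w 1 := by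
        simp [FreeAlg.of, MonoidAlgebra.single_mul_single]
      rw [this, mk_mul]
      exact gen_mul_mem_spanPairs R g ih
  induction x using MonoidAlgebra.induction_linear with
  | zero => exact zero_mem _
  | add x y hx hy => exact add_mem hx hy
  | single w c =>
    have : (MonoidAlgebra.single w c : Λ.FreeAlg R) = c • MonoidAlgebra.single w 1 := by
      simp [MonoidAlgebra.smul_single]
    rw [this, mk_smul]
    exact Submodule.smul_mem _ _ (key w)

/-! ### Universal property -/

/-- A map of the generators into an `R`-algebra that respects the relations induces an `R`-linear
map on the Kumjian--Pask algebra that is multiplicative. -/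
theorem exists_lift {S : Type*} [Ring S] [Algebra R S] (f : Λ.Gen → S)
    (hf : ∀ F : Λ.FreeAlg R →ₙₐ[R] S, (∀ g, F (FreeAlg.of R g) = f g) →
      ∀ x y, Λ.KPRel R x y → F x = F y) :
    ∃ φ : Λ.KP R →ₗ[R] S, (∀ g, φ (mk Λ R (FreeAlg.of R g)) = f g) ∧
      ∀ x y, φ (x * y) = φ x * φ y := by
  let F : Λ.FreeAlg R →ₙₐ[R] S := MonoidAlgebra.liftMagma R (FreeSemigroup.lift f)
  have hF : ∀ g, F (FreeAlg.of R g) = f g := fun g => by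
    simp [F, FreeAlg.of]
  have hcon : ∀ x y, Λ.kpCon R x y → F x = F y := by
    intro x y h
    change RingConGen.Rel _ _ _ at h
    induction h with
    | of x y h =>
      obtain ⟨c, x₀, y₀, h, rfl, rfl⟩ := h
      rw [map_smul, map_smul, hf F hF _ _ h]
    | refl x => rfl
    | symm _ ih => exact ih.symm
    | trans _ _ ih₁ ih₂ => exact ih₁.trans ih₂
    | add _ _ ih₁ ih₂ => rw [map_add, map_add, ih₁, ih₂]
    | mul _ _ ih₁ ih₂ => rw [map_mul, map_mul, ih₁, ih₂]
  refine ⟨{ toFun := Quotient.lift F hcon, map_add' := ?_, map_smul' := ?_ }, hF, ?_⟩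
  · rintro ⟨x⟩ ⟨y⟩
    exact map_add F x y
  · rintro c ⟨x⟩
    exact map_smul F c x
  · rintro ⟨x⟩ ⟨y⟩
    exact map_mul F x y

end KP

end KGraph

/-! ### Representation on functions of infinite paths -/

namespace StdPath

variable {k l : ℕ} (R : Type*) [CommRing R]

/-- Vertices together with an infinite word; a model of the infinite paths of the standard
`k`-graph of level `l`. -/
abbrev InfPath (k l : ℕ) : Type := (Fin k → ℤ) × Stream' (Fin l)

/-- The projection onto the functions supported on the infinite paths of range `v`. -/
def vertexOp (v : Fin k → ℤ) : Module.End R (InfPath k l → R) where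
  toFun φ := fun y => if y.1 = v then φ y else 0
  map_add' _ _ := by ext y; by_cases h : y.1 = v <;> simp [h]
  map_smul' _ _ := by ext y; by_cases h : y.1 = v <;> simp [h]

/-- The action of a path on functions of infinite paths. -/
def pathOp (a : StdPath k l) : Module.End R (InfPath k l → R) where
  toFun φ := fun y =>
    if y.1 = a.rng ∧ y.2.take a.lv.length = a.lv then φ (a.src, y.2.drop a.lv.length) else 0
  map_add' _ _ := by ext y; dsimp only [Pi.add_apply]; split_ifs <;> simp
  map_smul' _ _ := by ext y; dsimp only [Pi.smul_apply]; split_ifs <;> simp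

/-- The action of a ghost path on functions of infinite paths. -/
def ghostOp (a : StdPath k l) : Module.End R (InfPath k l → R) where
  toFun φ := fun y => if y.1 = a.src then φ (a.rng, a.lv ++ₛ y.2) else 0
  map_add' _ _ := by ext y; dsimp only [Pi.add_apply]; split_ifs <;> simp
  map_smul' _ _ := by ext y; dsimp only [Pi.smul_apply]; split_ifs <;> simp

variable {R}

theorem vertexOp_apply (v : Fin k → ℤ) (φ : InfPath k l → R) (y : InfPath k l) :
    vertexOp R v φ y = if y.1 = v then φ y else 0 := rfl

theorem pathOp_apply (a : StdPath k l) (φ : InfPath k l → R) (y : InfPath k l) :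
    pathOp R a φ y =
      if y.1 = a.rng ∧ y.2.take a.lv.length = a.lv then φ (a.src, y.2.drop a.lv.length)
      else 0 := rfl

theorem ghostOp_apply (a : StdPath k l) (φ : InfPath k l → R) (y : InfPath k l) :
    ghostOp R a φ y = if y.1 = a.src then φ (a.rng, a.lv ++ₛ y.2) else 0 := rfl

theorem lv_eq_nil {a : StdPath k l} (h : a.deg = 0) : a.lv = [] :=
  List.length_eq_zero_iff.mp (by simp [length_eq, h])

theorem src_eq_rng {a : StdPath k l} (h : a.deg = 0) : a.src = a.rng := by
  simp [src_eq a, h]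

theorem pathOp_of_deg_eq_zero {a : StdPath k l} (h : a.deg = 0) :
    pathOp R a = vertexOp R a.rng := by
  ext φ ⟨u, x⟩
  rw [pathOp_apply, vertexOp_apply, lv_eq_nil h, src_eq_rng h]
  by_cases h1 : u = a.rng <;> simp [h1]

theorem ghostOp_of_deg_eq_zero {a : StdPath k l} (h : a.deg = 0) :
    ghostOp R a = vertexOp R a.rng := by
  ext φ ⟨u, x⟩
  rw [ghostOp_apply, vertexOp_apply, lv_eq_nil h, src_eq_rng h]
  by_cases h1 : u = a.rng <;> simp [h1]

theorem vertexOp_mul_vertexOp (v w : Fin k → ℤ) :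
    vertexOp R v * vertexOp R w = if v = w then (vertexOp R v : Module.End R (InfPath k l → R))
      else 0 := by
  ext φ y
  by_cases hvw : v = w
  · subst hvw
    simp only [Module.End.mul_apply, vertexOp_apply, if_true]
    split_ifs <;> rfl
  · simp only [Module.End.mul_apply, vertexOp_apply, if_neg hvw]
    split_ifs with h1 h2
    · exact absurd (h1.symm.trans h2) hvw
    · rfl
    · rfl

theorem take_length_append_eq_iff (x : Stream' (Fin l)) (p q : List (Fin l)) :
    x.take (p ++ q).length = p ++ q ↔
      x.take p.length = p ∧ (x.drop p.length).take q.length = q := by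
  rw [List.length_append, Stream'.take_add]
  exact ⟨fun h => List.append_inj h (by simp), fun h => by rw [h.1, h.2]⟩

theorem pathOp_mul_pathOp (a b : StdPath k l) (h : a.src = b.rng) :
    pathOp R a * pathOp R b = pathOp R (a.comp b h) := by
  ext φ y
  simp only [Module.End.mul_apply, pathOp_apply, comp, take_length_append_eq_iff]
  by_cases h1 : y.1 = a.rng ∧ y.2.take a.lv.length = a.lv
  · simp [h1, h]
  · rw [if_neg h1, if_neg fun h2 => h1 ⟨h2.1, h2.2.1⟩]

theorem ghostOp_mul_ghostOp (a b : StdPath k l) (h : a.src = b.rng) :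
    ghostOp R b * ghostOp R a = ghostOp R (a.comp b h) := by
  ext φ y
  simp [Module.End.mul_apply, ghostOp_apply, comp, h]

theorem vertexOp_mul_pathOp (a : StdPath k l) :
    vertexOp R a.rng * pathOp R a = pathOp R a := by
  ext φ y
  simp only [Module.End.mul_apply, vertexOp_apply, pathOp_apply]
  by_cases h : y.1 = a.rng <;> simp [h]

theorem pathOp_mul_vertexOp (a : StdPath k l) :
    pathOp R a * vertexOp R a.src = pathOp R a := by
  ext φ y
  simp [Module.End.mul_apply, vertexOp_apply, pathOp_apply]

theorem vertexOp_mul_ghostOp (a : StdPath k l) :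
    vertexOp R a.src * ghostOp R a = ghostOp R a := by
  ext φ y
  simp only [Module.End.mul_apply, vertexOp_apply, ghostOp_apply]
  by_cases h : y.1 = a.src <;> simp [h]

theorem ghostOp_mul_vertexOp (a : StdPath k l) :
    ghostOp R a * vertexOp R a.rng = ghostOp R a := by
  ext φ y
  simp [Module.End.mul_apply, vertexOp_apply, ghostOp_apply]

theorem ghostOp_mul_pathOp_self (a : StdPath k l) :
    ghostOp R a * pathOp R a = vertexOp R a.src := by
  ext φ ⟨u, x⟩
  simp only [Module.End.mul_apply, vertexOp_apply, ghostOp_apply, pathOp_apply]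
  by_cases h : u = a.src <;>
    simp [h, Stream'.take_append_of_le_length, Stream'.drop_append_stream]

theorem ghostOp_mul_pathOp_of_ne {a b : StdPath k l} (hd : a.deg = b.deg) (h : a ≠ b) :
    ghostOp R a * pathOp R b = 0 := by
  ext φ y
  have hlen : a.lv.length = b.lv.length := by rw [length_eq, length_eq, hd]
  simp only [Module.End.mul_apply, ghostOp_apply, pathOp_apply]
  split_ifs with h1 h2
  · rw [← hlen, Stream'.take_append_of_le_length _ _ _ le_rfl, List.take_length] at h2
    exact absurd (ext_deg h2.1 hd h2.2) h
  · rfl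
  · rfl

/-- This prefix-exchange formula yields all coefficients used for linear independence. The source
test inside `ghostOp` disappears because the sources agree. -/
theorem pathOp_mul_ghostOp_apply {a b : StdPath k l} (h : a.src = b.src) (φ : InfPath k l → R)
    (y : InfPath k l) :
    (pathOp R a * ghostOp R b) φ y =
      if y.1 = a.rng ∧ y.2.take a.lv.length = a.lv
      then φ (b.rng, b.lv ++ₛ y.2.drop a.lv.length) else 0 := by
  simp [Module.End.mul_apply, ghostOp_apply, pathOp_apply, h]

/-- An infinite word has exactly one prefix of length `∑ i, n i`, so at each point over `v` exactly
one summand acts, and it removes that prefix and puts it back. -/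
theorem vertexOp_eq_sum (v : Fin k → ℤ) {n : Fin k → ℕ} (hn : n ≠ 0) :
    vertexOp R v = ∑ a ∈ KGraph.pathsOfDegree (Λ := stdKGraph k l) v n,
      pathOp R a.1 * ghostOp R a.1 := by
  ext φ y
  simp only [LinearMap.sum_apply, Finset.sum_apply, pathOp_mul_ghostOp_apply rfl, vertexOp_apply]
  have hzero : ∀ a ∈ KGraph.pathsOfDegree (Λ := stdKGraph k l) v n, a.1.rng = v :=
    fun a ha => (KGraph.mem_pathsOfDegree.mp ha).1
  by_cases hv : y.1 = v
  · let p : StdPath k l := ofDeg v n (y.2.take (∑ i, n i)) (by simp)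
    have hp : p.deg = n := deg_ofDeg ..
    have hlv : p.lv = y.2.take (∑ i, n i) := rfl
    rw [Finset.sum_eq_single (⟨p, hp.trans_ne hn⟩ : StdNonzeroPath k l)]
    · have h1 : y.1 = p.rng := hv
      simp only [h1, hlv, Stream'.length_take, true_and, if_true, Stream'.append_take_drop]
      rw [← h1, if_pos hv]
    · intro a ha hne
      refine if_neg fun h => hne (Subtype.ext (ext_deg ?_ ?_ ?_))
      · exact hzero a ha
      · exact (KGraph.mem_pathsOfDegree.mp ha).2.trans hp.symm
      · rw [← h.2, hlv, length_eq]
        congr 2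
        exact (KGraph.mem_pathsOfDegree.mp ha).2
    · intro h
      exact absurd (KGraph.mem_pathsOfDegree.mpr ⟨rfl, hp⟩) h
  · rw [if_neg hv, Finset.sum_eq_zero]
    intro a ha
    rw [if_neg]
    rw [hzero a ha]
    exact fun h => hv h.1

variable (R) in
/-- The Kumjian--Pask algebra of the standard `k`-graph acts on the functions of infinite paths. -/
theorem exists_infPath_representation (k l : ℕ) :
    ∃ π : (stdKGraph k l).KP R →ₗ[R] Module.End R (InfPath k l → R),
      (∀ x y, π (x * y) = π x * π y) ∧ (∀ a, π (KGraph.KP.pathOf R a) = pathOp R a) ∧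
      ∀ a, π (KGraph.KP.ghostOf R a) = ghostOp R a := by
  obtain ⟨π, hπ, hmul⟩ := KGraph.KP.exists_lift (Λ := stdKGraph k l) R
    (S := Module.End R (InfPath k l → R))
    (fun g => match g with
      | .vertex v => vertexOp R v
      | .path a => pathOp R a.1
      | .ghost a => ghostOp R a.1)
    (by
      intro F hF x y h
      cases h with
      | vertex_idem v => simp [hF, vertexOp_mul_vertexOp]
      | vertex_orth v w h => simp [hF, vertexOp_mul_vertexOp, h]
      | path_mul a b h => simp [hF, pathOp_mul_pathOp a.1 b.1 h, KGraph.NonzeroPath.comp]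
      | ghost_mul a b h => simp [hF, ghostOp_mul_ghostOp a.1 b.1 h, KGraph.NonzeroPath.comp]
      | r_mul_path a => simp [hF, vertexOp_mul_pathOp]
      | path_mul_s a => simp [hF, pathOp_mul_vertexOp]
      | s_mul_ghost a => simp [hF, vertexOp_mul_ghostOp]
      | ghost_mul_r a => simp [hF, ghostOp_mul_vertexOp]
      | ghost_mul_path_self a => simp [hF, ghostOp_mul_pathOp_self]
      | ghost_mul_path_ne a b hd h =>
        simp [hF, ghostOp_mul_pathOp_of_ne hd (Subtype.coe_injective.ne h)]
      | vertex_eq_sum v n hn => simp [hF, vertexOp_eq_sum v hn, map_sum])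
  refine ⟨π, hmul, fun a => ?_, fun a => ?_⟩
  · by_cases h : a.deg = 0
    · exact (congrArg π (KGraph.KP.pathOf_of_eq_zero R h)).trans
        ((hπ (.vertex a.rng)).trans (pathOp_of_deg_eq_zero h).symm)
    · exact (congrArg π (KGraph.KP.pathOf_coe R (Λ := stdKGraph k l) ⟨a, h⟩)).trans
        (hπ (.path ⟨a, h⟩))
  · by_cases h : a.deg = 0
    · exact (congrArg π (KGraph.KP.ghostOf_of_eq_zero R h)).trans
        ((hπ (.vertex a.rng)).trans (ghostOp_of_deg_eq_zero h).symm)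
    · exact (congrArg π (KGraph.KP.ghostOf_coe R (Λ := stdKGraph k l) ⟨a, h⟩)).trans
        (hπ (.ghost ⟨a, h⟩))

end StdPath

/-! ### Infinite words and common tails -/

namespace StdPath

variable {k l : ℕ}

theorem lv_eq_nil_iff {a : StdPath k l} : a.lv = [] ↔ a.deg = 0 := by
  refine ⟨fun h => ?_, lv_eq_nil⟩
  have h1 := a.length_eq
  rw [h, List.length_nil, eq_comm, Finset.sum_eq_zero_iff] at h1
  funext i
  exact h1 i (Finset.mem_univ i)

theorem length_lv_eq_sub (a : StdPath k l) :
    (a.lv.length : ℤ) = ∑ i, a.rng i - ∑ i, a.src i := by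
  rw [a.length_lv, Finset.sum_sub_distrib]

theorem replicate_append_const {α : Type*} (x : α) (n : ℕ) :
    List.replicate n x ++ₛ Stream'.const x = Stream'.const x := by
  induction n with
  | zero => rfl
  | succ n ih =>
    rw [List.replicate_succ, Stream'.cons_append_stream, ih]
    exact (Stream'.const_eq x).symm

/-- Range and word fix the total weight of the source but not the source itself; this is the freedom
that `PairEquiv` absorbs. -/
theorem sum_src_eq {a a' : StdPath k l} (hr : a.rng = a'.rng) (hl : a.lv = a'.lv) :
    ∑ i, a.src i = ∑ i, a'.src i := by
  have e1 := a.length_lv_eq_sub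
  have e3 := a'.length_lv_eq_sub
  rw [hr, hl] at e1
  linarith

/-- The path of degree zero at `v`. -/
def nil (v : Fin k → ℤ) : StdPath k l := (stdKGraph k l).ident v

theorem deg_nil (v : Fin k → ℤ) : (nil v : StdPath k l).deg = 0 := (stdKGraph k l).d_ident v

variable [NeZero l]

/-- The infinite word obtained from a path by appending `1`s. -/
def word (a : StdPath k l) : Stream' (Fin l) := a.lv ++ₛ Stream'.const 0

theorem lv_extendOnes (a : StdPath k l) (n : Fin k → ℕ) :
    (a.extendOnes n).lv = a.lv ++ List.replicate (∑ i, n i) 0 := rfl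

theorem rng_extendOnes (a : StdPath k l) (n : Fin k → ℕ) : (a.extendOnes n).rng = a.rng := rfl

theorem src_extendOnes (a : StdPath k l) (n : Fin k → ℕ) :
    (a.extendOnes n).src = fun i => a.src i - n i := rfl

theorem word_extendOnes (a : StdPath k l) (n : Fin k → ℕ) : (a.extendOnes n).word = a.word := by
  rw [word, lv_extendOnes, Stream'.append_append_stream, replicate_append_const, word]

theorem extendOnes_extendOnes (a : StdPath k l) (m n : Fin k → ℕ) :
    (a.extendOnes m).extendOnes n = a.extendOnes (m + n) := by
  refine StdPath.ext rfl ?_ ?_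
  · funext i
    simp only [src_extendOnes, Pi.add_apply]
    push_cast
    ring
  · simp only [lv_extendOnes, List.append_assoc, List.replicate_append_replicate, Pi.add_apply,
      Finset.sum_add_distrib]

/-- The paths `a` and `b` have no common tail `λ^{v,n}` with `n ≠ 0`. -/
def NoCommonTail (a b : StdPath k l) : Prop :=
  ¬ ∃ (n : Fin k → ℕ) (a' b' : StdPath k l), n ≠ 0 ∧ a = a'.extendOnes n ∧ b = b'.extendOnes n

theorem sum_ne_zero {n : Fin k → ℕ} (hn : n ≠ 0) : ∑ i, n i ≠ 0 := by
  intro h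
  rw [Finset.sum_eq_zero_iff] at h
  exact hn (funext fun i => h i (Finset.mem_univ i))

theorem noCommonTail_of_deg_left {a b : StdPath k l} (h : a.deg = 0) : NoCommonTail a b := by
  rintro ⟨n, a', b', hn, rfl, rfl⟩
  have h1 := lv_eq_nil h
  simp [lv_extendOnes, sum_ne_zero hn] at h1

theorem noCommonTail_of_deg_right {a b : StdPath k l} (h : b.deg = 0) : NoCommonTail a b := by
  rintro ⟨n, a', b', hn, rfl, rfl⟩
  have h1 := lv_eq_nil h
  simp [lv_extendOnes, sum_ne_zero hn] at h1

theorem noCommonTail_of_last_ne {a b : StdPath k l} {p : List (Fin l)} {x : Fin l}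
    (h : a.lv = p ++ [x]) (hx : x ≠ 0) : NoCommonTail a b := by
  rintro ⟨n, a', b', hn, rfl, rfl⟩
  obtain ⟨m, hm⟩ := Nat.exists_eq_succ_of_ne_zero (sum_ne_zero hn)
  rw [lv_extendOnes, hm, List.replicate_succ', ← List.append_assoc] at h
  exact hx (by simpa using (List.append_inj_right' h rfl).symm)

/-- The last letter of `q` stands at a position beyond `p`, where the other word is constantly `0`.
-/
theorem exists_eq_append_zero {p q : List (Fin l)}
    (h : p ++ₛ Stream'.const 0 = q ++ₛ Stream'.const 0) (hlt : p.length < q.length) :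
    ∃ r, q = r ++ [0] := by
  have hq : q ≠ [] := by
    rintro rfl
    simp at hlt
  refine ⟨q.dropLast, ?_⟩
  conv_lhs => rw [← List.dropLast_append_getLast hq]
  congr 2
  have h1 := congrArg (fun s => s.get (q.length - 1)) h
  rw [Stream'.get_append_left (q.length - 1) q _ (by omega)] at h1
  rw [List.getLast_eq_getElem, ← h1]
  obtain ⟨m, hm⟩ := Nat.exists_eq_add_of_le (Nat.le_sub_one_of_lt hlt)
  rw [hm, Stream'.get_append_right]
  rfl

/-- Strip a final `1` in the direction `i`. -/
theorem exists_eq_extendOnes_single {a : StdPath k l} {p : List (Fin l)} (h : a.lv = p ++ [0])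
    {i : Fin k} (hi : a.src i < a.rng i) :
    ∃ a' : StdPath k l, a = a'.extendOnes (Pi.single i 1) := by
  refine ⟨⟨a.rng, a.src + Pi.single i 1, p, ?_, ?_⟩, ?_⟩
  · intro j
    by_cases hj : j = i
    · subst hj
      simpa using hi
    · simpa [hj] using a.le j
  · have := a.length_lv
    rw [h, List.length_append] at this
    simp only [Pi.add_apply, Finset.sum_sub_distrib, Finset.sum_add_distrib,
      Finset.sum_pi_single'] at this ⊢
    simp at this ⊢
    linarith
  · refine StdPath.ext rfl ?_ ?_
    · funext j
      by_cases hj : j = i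
      · subst hj
        simp [src_extendOnes]
      · simp [src_extendOnes, hj]
    · simp [lv_extendOnes, h]

/-- If `a'` were longer than `a`, then `b'` would be longer than `b` by the same amount, and both
would end in `0`. Either some direction is available in both to strip this letter, giving a common
tail, or in every direction the source of the primed pair already reaches one of the two ranges. In
the latter case it lies above the source of the other pair, which contradicts the lengths. -/
theorem length_le_of_word_eq {a b a' b' : StdPath k l} (hs : a.src = b.src)
    (hs' : a'.src = b'.src) (hra : a.rng = a'.rng) (hrb : b.rng = b'.rng)
    (hwa : a.word = a'.word) (hwb : b.word = b'.word) (hA : NoCommonTail a' b') :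
    a'.lv.length ≤ a.lv.length := by
  by_contra! hlt
  have e1 := a.length_lv_eq_sub
  have e2 := b.length_lv_eq_sub
  have e3 := a'.length_lv_eq_sub
  have e4 := b'.length_lv_eq_sub
  rw [hs, hra] at e1
  rw [hrb] at e2
  rw [hs'] at e3
  obtain ⟨p, hp⟩ := exists_eq_append_zero hwa hlt
  obtain ⟨q, hq⟩ := exists_eq_append_zero hwb (by omega)
  by_cases hex : ∃ i, a'.src i < a'.rng i ∧ b'.src i < b'.rng i
  · obtain ⟨i, h1, h2⟩ := hex
    obtain ⟨c, hc⟩ := exists_eq_extendOnes_single hp h1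
    obtain ⟨d, hd⟩ := exists_eq_extendOnes_single hq h2
    exact hA ⟨_, c, d, by simp, hc, hd⟩
  · push Not at hex
    have hle : ∑ i, b.src i ≤ ∑ i, b'.src i := by
      refine Finset.sum_le_sum fun i _ => ?_
      have h1 := hex i
      have h2 := a.le i
      have h3 := b.le i
      rw [hs, hra] at h2
      rw [hrb] at h3
      rw [hs'] at h1
      by_cases h4 : b'.src i < a'.rng i
      · exact h3.trans (h1 h4)
      · exact h2.trans (not_lt.mp h4)
    omega

theorem lv_eq_of_word_eq {a b a' b' : StdPath k l} (hs : a.src = b.src)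
    (hs' : a'.src = b'.src) (hra : a.rng = a'.rng) (hrb : b.rng = b'.rng)
    (hwa : a.word = a'.word) (hwb : b.word = b'.word) (hA : NoCommonTail a b)
    (hA' : NoCommonTail a' b') : a.lv = a'.lv ∧ b.lv = b'.lv := by
  have h1 := length_le_of_word_eq hs hs' hra hrb hwa hwb hA'
  have h2 := length_le_of_word_eq hs' hs hra.symm hrb.symm hwa.symm hwb.symm hA
  have e1 := a.length_lv_eq_sub
  have e2 := b.length_lv_eq_sub
  have e3 := a'.length_lv_eq_sub
  have e4 := b'.length_lv_eq_sub
  rw [hs, hra] at e1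
  rw [hrb] at e2
  rw [hs'] at e3
  exact ⟨Stream'.append_left_injective _ _ _ _ hwa (by omega),
    Stream'.append_left_injective _ _ _ _ hwb (by omega)⟩

/-- Two vertices of the same total weight have a common lower bound, strictly below both. -/
theorem exists_common_lower [NeZero k] {u v : Fin k → ℤ} (h : ∑ i, u i = ∑ i, v i) :
    ∃ m n : Fin k → ℕ, m ≠ 0 ∧ n ≠ 0 ∧ ∑ i, m i = ∑ i, n i ∧
      (fun i => u i - m i) = fun i => v i - n i := by
  -- The `- 1` below the minimum keeps both degrees nonzero, as (KP4) and `PairEquiv` demand;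
  -- coordinate `0` witnesses this.
  let m : Fin k → ℕ := fun i => (u i - (min (u i) (v i) - 1)).toNat
  let n : Fin k → ℕ := fun i => (v i - (min (u i) (v i) - 1)).toNat
  have hm : ∀ i, (m i : ℤ) = u i - (min (u i) (v i) - 1) := fun i => by
    simp only [m]; omega
  have hn : ∀ i, (n i : ℤ) = v i - (min (u i) (v i) - 1) := fun i => by
    simp only [n]; omega
  refine ⟨m, n, fun h0 => ?_, fun h0 => ?_, ?_, ?_⟩
  · have h1 := hm 0
    rw [h0, Pi.zero_apply] at h1
    omega
  · have h1 := hn 0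
    rw [h0, Pi.zero_apply] at h1
    omega
  · zify
    simp only [hm, hn, Finset.sum_sub_distrib, h]
  · funext i
    rw [hm, hn]
    ring

end StdPath

/-! ### Reduction to pairs without common tail -/

section KP

open KGraph.KP

variable {k l : ℕ} (R : Type*) [CommRing R]

namespace StdPath

theorem sum_pathsOfDegree {M : Type*} [AddCommMonoid M] (v : Fin k → ℤ) {n : Fin k → ℕ}
    (hn : n ≠ 0) {N : ℕ} (hN : ∑ i, n i = N) (f : StdPath k l → M) :
    ∑ c ∈ KGraph.pathsOfDegree (Λ := stdKGraph k l) v n, f c.1 =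
      ∑ p : Fin N → Fin l, f (ofDeg v n (List.ofFn p) (by simp [hN])) := by
  symm
  refine Finset.sum_bij (fun p _ => ⟨ofDeg v n (List.ofFn p) (by simp [hN]),
    (deg_ofDeg v n _ _).trans_ne hn⟩) ?_ ?_ ?_ ?_
  · intro p _
    exact KGraph.mem_pathsOfDegree.mpr ⟨rfl, deg_ofDeg v n _ (by simp [hN])⟩
  · intro p _ q _ h
    exact List.ofFn_injective (congrArg (fun c => c.1.lv) h)
  · intro c hc
    obtain ⟨hr, hd⟩ := KGraph.mem_pathsOfDegree.mp hc
    have hlen : c.1.lv.length = N := by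
      rw [length_eq, ← hN]
      exact congrArg (fun d : Fin k → ℕ => ∑ i, d i) hd
    subst hlen
    refine ⟨c.1.lv.get, Finset.mem_univ _, Subtype.ext (ext_deg hr.symm ?_ ?_)⟩
    · exact (deg_ofDeg v n _ (by simp [hN])).trans hd.symm
    · exact List.ofFn_get _
  · intro p _
    rfl

/-- The Cuntz--Krieger expansion of `a b*`, indexed by words. -/
theorem pathOf_mul_ghostOf_eq_sum_words {a b : StdPath k l} (h : a.src = b.src)
    {n : Fin k → ℕ} (hn : n ≠ 0) {N : ℕ} (hN : ∑ i, n i = N) :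
    pathOf (Λ := stdKGraph k l) R a * ghostOf (Λ := stdKGraph k l) R b =
      ∑ p : Fin N → Fin l,
        pathOf (Λ := stdKGraph k l) R
          (a.comp (ofDeg a.src n (List.ofFn p) (by simp [hN])) rfl) *
        ghostOf (Λ := stdKGraph k l) R
          (b.comp (ofDeg a.src n (List.ofFn p) (by simp [hN])) h.symm) := by
  refine (KGraph.KP.pathOf_mul_ghostOf_eq_sum (Λ := stdKGraph k l) R h hn).trans
    ((sum_pathsOfDegree a.src hn hN fun c =>
      (pathOf (Λ := stdKGraph k l) R a * pathOf (Λ := stdKGraph k l) R c) *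
        (ghostOf (Λ := stdKGraph k l) R c * ghostOf (Λ := stdKGraph k l) R b)).trans
      (Finset.sum_congr rfl fun p _ => ?_))
  exact congrArg₂ (· * ·) (pathOf_mul_pathOf (Λ := stdKGraph k l) R rfl)
    (ghostOf_mul_ghostOf (Λ := stdKGraph k l) R h.symm)

/-- The element `a b*` depends only on the ranges and the words of `a` and `b`. -/
theorem pathOf_mul_ghostOf_congr [NeZero k] {a b a' b' : StdPath k l} (hs : a.src = b.src)
    (hs' : a'.src = b'.src) (hra : a.rng = a'.rng) (hrb : b.rng = b'.rng)
    (hla : a.lv = a'.lv) (hlb : b.lv = b'.lv) :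
    pathOf (Λ := stdKGraph k l) R a * ghostOf (Λ := stdKGraph k l) R b =
      pathOf (Λ := stdKGraph k l) R a' * ghostOf (Λ := stdKGraph k l) R b' := by
  obtain ⟨m, n, hm, hn, hsum, hmn⟩ := exists_common_lower (sum_src_eq hra hla)
  rw [pathOf_mul_ghostOf_eq_sum_words R hs hm hsum,
    pathOf_mul_ghostOf_eq_sum_words R hs' hn rfl]
  refine Finset.sum_congr rfl fun p _ => congrArg₂ (· * ·) (congrArg _ ?_) (congrArg _ ?_)
  · exact StdPath.ext hra hmn (congrArg (· ++ _) hla)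
  · exact StdPath.ext hrb hmn (congrArg (· ++ _) hlb)

variable [NeZero l]

/-- The elements `a b*` without common tail span. -/
theorem pathOf_mul_ghostOf_mem_of_noCommonTail {S : Submodule R ((stdKGraph k l).KP R)}
    (hS : ∀ a b : StdPath k l, a.src = b.src → NoCommonTail a b →
      pathOf (Λ := stdKGraph k l) R a * ghostOf (Λ := stdKGraph k l) R b ∈ S)
    (a b : StdPath k l) (h : a.src = b.src) :
    pathOf (Λ := stdKGraph k l) R a * ghostOf (Λ := stdKGraph k l) R b ∈ S := by
  induction hN : a.lv.length generalizing a b with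
  | zero =>
    exact hS a b h (noCommonTail_of_deg_left
      (lv_eq_nil_iff.mp (List.length_eq_zero_iff.mp hN)))
  | succ N ih =>
    by_cases hA : NoCommonTail a b
    · exact hS a b h hA
    obtain ⟨n, a₀, b₀, hn, rfl, rfl⟩ := not_not.mp hA
    obtain ⟨i, hi⟩ := Function.ne_iff.mp hn
    -- Only one edge of the tail is stripped, so that the expansion below runs over single levels.
    have hsplit : n = (n - Pi.single i 1) + Pi.single i 1 := by
      refine (tsub_add_cancel_of_le fun j => ?_).symm
      by_cases hj : j = i
      · subst hj
        simpa using Nat.one_le_iff_ne_zero.mpr hi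
      · simp [hj]
    rw [hsplit, ← extendOnes_extendOnes, ← extendOnes_extendOnes] at h ⊢
    rw [hsplit, ← extendOnes_extendOnes] at hN
    generalize a₀.extendOnes (n - Pi.single i 1) = a at *
    generalize b₀.extendOnes (n - Pi.single i 1) = b at *
    have hab : a.src = b.src := by
      funext j
      have := congrFun h j
      simp only [src_extendOnes] at this
      omega
    have hone : ∑ j, (Pi.single i 1 : Fin k → ℕ) j = 1 := by simp
    have hmem := ih a b hab (by
      rw [lv_extendOnes, hone] at hN
      simpa using hN)
    -- The term at level `0` is the product in question; the left side lies in `S` by induction, and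
    -- the remaining terms do so because their last level is not `0`.
    rw [pathOf_mul_ghostOf_eq_sum_words R hab (by simp) hone,
      ← Finset.add_sum_erase _ _ (Finset.mem_univ (0 : Fin 1 → Fin l))] at hmem
    have hrest : ∀ p ∈ Finset.univ.erase (0 : Fin 1 → Fin l),
        pathOf (Λ := stdKGraph k l) R
          (a.comp (ofDeg a.src (Pi.single i 1) (List.ofFn p) (by simp)) rfl) *
        ghostOf (Λ := stdKGraph k l) R
          (b.comp (ofDeg a.src (Pi.single i 1) (List.ofFn p) (by simp)) hab.symm) ∈ S := by
      intro p hp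
      refine hS _ _ rfl (noCommonTail_of_last_ne (p := a.lv) (x := p 0) (by simp [comp, ofDeg]) ?_)
      intro h0
      refine (Finset.mem_erase.mp hp).1 (funext fun j => ?_)
      rw [Subsingleton.elim j 0, h0]
      rfl
    convert (S.add_mem_iff_left (sum_mem hrest)).mp hmem using 1
    refine congrArg₂ (· * ·) (congrArg _ ?_) (congrArg _ ?_)
    · exact StdPath.ext rfl rfl (by simp [lv_extendOnes, comp, ofDeg])
    · refine StdPath.ext rfl ?_ (by simp [lv_extendOnes, comp, ofDeg])
      simp [src_extendOnes, comp, ofDeg, hab]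

end StdPath

end KP

/-! ### Linear independence -/

/-- A family that is triangular with unit diagonal against a family of functionals is linearly
independent. -/
theorem linearIndependent_of_triangular {ι R M : Type*} [CommRing R] [AddCommGroup M] [Module R M]
    (b : ι → M) (f : ι → M →ₗ[R] R) (rank : ι → ℕ) (hdiag : ∀ i, f i (b i) = 1)
    (htri : ∀ i j, f i (b j) ≠ 0 → j = i ∨ rank j < rank i) : LinearIndependent R b := by
  rw [linearIndependent_iff']
  intro s g hg
  have key : ∀ n, ∀ i ∈ s, rank i = n → g i = 0 := by
    intro n
    induction n using Nat.strong_induction_on with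
    | _ n ih =>
      rintro i hi rfl
      have h1 := congrArg (f i) hg
      rw [map_sum, map_zero, Finset.sum_eq_single i] at h1
      · simpa [hdiag] using h1
      · intro j hj hji
        rw [map_smul, smul_eq_mul]
        by_cases h0 : f i (b j) = 0
        · rw [h0, mul_zero]
        · rw [ih _ ((htri i j h0).resolve_left hji) j hj rfl, zero_mul]
      · exact fun h => absurd hi h
  exact fun i hi => key _ i hi rfl

namespace StdPath

open KGraph.KP

variable {k l : ℕ} {R : Type*} [CommRing R]

theorem lv_ne_nil (a : StdNonzeroPath k l) : a.1.lv ≠ [] := fun h => a.2 (lv_eq_nil_iff.mp h)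

theorem pathOf_nil (v : Fin k → ℤ) :
    pathOf (Λ := stdKGraph k l) R (nil v) = vertex (Λ := stdKGraph k l) R v :=
  pathOf_of_eq_zero (Λ := stdKGraph k l) R (deg_nil v)

theorem ghostOf_nil (v : Fin k → ℤ) :
    ghostOf (Λ := stdKGraph k l) R (nil v) = vertex (Λ := stdKGraph k l) R v :=
  ghostOf_of_eq_zero (Λ := stdKGraph k l) R (deg_nil v)

variable [NeZero l]

/-- A family of elements `a b*` is linearly independent if its members are determined by the ranges
of `a` and `b` and the infinite words of `a` and `b`. -/
theorem linearIndependent_pathOf_mul_ghostOf {ι : Type*} (p : ι → StdPath k l × StdPath k l)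
    (hsrc : ∀ i, (p i).1.src = (p i).2.src)
    (hinj : ∀ i j, (p i).1.rng = (p j).1.rng → (p i).2.rng = (p j).2.rng →
      (p i).1.word = (p j).1.word → (p i).2.word = (p j).2.word → i = j) :
    LinearIndependent R fun i =>
      pathOf (Λ := stdKGraph k l) R (p i).1 * ghostOf (Λ := stdKGraph k l) R (p i).2 := by
  classical
  obtain ⟨π, hmul, hpath, hghost⟩ := exists_infPath_representation R k l
  -- The matrix coefficient of the action from the point given by the second path of the pair to the
  -- point given by the first.
  let f : ι → (stdKGraph k l).KP R →ₗ[R] R := fun i =>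
    LinearMap.proj ((p i).1.rng, (p i).1.word) ∘ₗ
      LinearMap.applyₗ (Pi.single ((p i).2.rng, (p i).2.word) (1 : R)) ∘ₗ π
  have hf : ∀ i j, f i (pathOf (Λ := stdKGraph k l) R (p j).1 *
      ghostOf (Λ := stdKGraph k l) R (p j).2) =
      if (p i).1.rng = (p j).1.rng ∧ (p i).1.word.take (p j).1.lv.length = (p j).1.lv
      then (Pi.single ((p i).2.rng, (p i).2.word) 1 : InfPath k l → R)
        ((p j).2.rng, (p j).2.lv ++ₛ (p i).1.word.drop (p j).1.lv.length)
      else 0 := by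
    intro i j
    simp only [f, LinearMap.comp_apply, hmul, hpath, hghost, LinearMap.applyₗ_apply_apply,
      LinearMap.proj_apply]
    exact pathOp_mul_ghostOp_apply (hsrc j) _ _
  have hdrop : ∀ i, (p i).1.word.drop (p i).1.lv.length = Stream'.const 0 := fun i =>
    Stream'.drop_append_stream _ _
  refine linearIndependent_of_triangular _ f
    (fun i => sInf {n | (p i).1.word.drop n = Stream'.const 0}) (fun i => ?_) (fun i j h => ?_)
  · rw [hf, if_pos, hdrop]
    · exact Pi.single_eq_same _ _
    · refine ⟨rfl, ?_⟩
      rw [word, Stream'.take_append_of_le_length _ _ _ le_rfl, List.take_length]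
  · rw [hf] at h
    split_ifs at h with h1
    swap
    · exact absurd rfl h
    have h2 : ((p j).2.rng, (p j).2.lv ++ₛ (p i).1.word.drop (p j).1.lv.length) =
        ((p i).2.rng, (p i).2.word) := by
      by_contra hne
      exact h (Pi.single_eq_of_ne hne _)
    rw [Prod.mk.injEq] at h2
    have hmem := Nat.sInf_mem (s := {n | (p i).1.word.drop n = Stream'.const 0}) ⟨_, hdrop i⟩
    have hle := Nat.sInf_le (s := {n | (p j).1.word.drop n = Stream'.const 0}) (hdrop j)
    -- A prefix shorter than the rank of `i` forces a smaller rank for `j`. Otherwise only `0`s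
    -- remain behind the prefix, so both pairs have the same infinite words.
    rcases lt_or_ge (p j).1.lv.length (sInf {n | (p i).1.word.drop n = Stream'.const 0})
      with hlt | hge
    · exact Or.inr (hle.trans_lt hlt)
    · left
      have h3 : (p i).1.word.drop (p j).1.lv.length = Stream'.const 0 := by
        rw [← Nat.add_sub_of_le hge, ← Stream'.drop_drop, hmem, Stream'.drop_const]
      refine hinj j i h1.1.symm h2.1 ?_ ?_
      · conv_rhs => rw [← Stream'.append_take_drop (p j).1.lv.length (p i).1.word, h1.2, h3]
        rfl
      · rw [← h2.2, h3]
        rfl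

/-! ### Representatives and assembly of the basis -/

/-- Equal ranges and equal words give equivalent pairs. -/
theorem pairEquiv_of_lv_eq [NeZero k] {x y : StdNonzeroPath k l × StdNonzeroPath k l}
    (hx : x.1.1.src = x.2.1.src) (hy : y.1.1.src = y.2.1.src)
    (hr₁ : x.1.1.rng = y.1.1.rng) (hr₂ : x.2.1.rng = y.2.1.rng)
    (hl₁ : x.1.1.lv = y.1.1.lv) (hl₂ : x.2.1.lv = y.2.1.lv) : PairEquiv x y := by
  obtain ⟨m, n, hm, hn, hsum, hmn⟩ := exists_common_lower (sum_src_eq hr₁ hl₁)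
  refine ⟨m, n, hm, hn, StdPath.ext hr₁ hmn ?_, StdPath.ext hr₂ ?_ ?_⟩
  · rw [lv_extendOnes, lv_extendOnes, hl₁, hsum]
  · rw [src_extendOnes, src_extendOnes, ← hx, ← hy]
    exact hmn
  · rw [lv_extendOnes, lv_extendOnes, hl₂, hsum]

/-- These invariants are complete on `pairsA`, through `lv_eq_of_word_eq` and `pairEquiv_of_lv_eq`.
-/
theorem rng_word_eq_of_pairEquiv {x y : StdNonzeroPath k l × StdNonzeroPath k l}
    (h : PairEquiv x y) : x.1.1.rng = y.1.1.rng ∧ x.2.1.rng = y.2.1.rng ∧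
      x.1.1.word = y.1.1.word ∧ x.2.1.word = y.2.1.word := by
  obtain ⟨m, n, -, -, h1, h2⟩ := h
  refine ⟨?_, ?_, ?_, ?_⟩
  · rw [← rng_extendOnes x.1.1 m, h1, rng_extendOnes]
  · rw [← rng_extendOnes x.2.1 m, h2, rng_extendOnes]
  · rw [← word_extendOnes x.1.1 m, h1, word_extendOnes]
  · rw [← word_extendOnes x.2.1 m, h2, word_extendOnes]

/-- The pairs of paths (possibly of degree zero) underlying the members of the basis. -/
def basisPair (𝓡 : Set (StdNonzeroPath k l × StdNonzeroPath k l)) :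
    (Fin k → ℤ) ⊕ StdNonzeroPath k l ⊕ StdNonzeroPath k l ⊕ 𝓡 → StdPath k l × StdPath k l
  | .inl v => (nil v, nil v)
  | .inr (.inl a) => (a.1, nil a.1.src)
  | .inr (.inr (.inl a)) => (nil a.1.src, a.1)
  | .inr (.inr (.inr x)) => (x.1.1.1, x.1.2.1)

variable {𝓡 : Set (StdNonzeroPath k l × StdNonzeroPath k l)}

theorem basisPair_src (h𝓡 : 𝓡 ⊆ pairsA k l)
    (i : (Fin k → ℤ) ⊕ StdNonzeroPath k l ⊕ StdNonzeroPath k l ⊕ 𝓡) :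
    (basisPair 𝓡 i).1.src = (basisPair 𝓡 i).2.src := by
  match i with
  | .inl v => rfl
  | .inr (.inl a) => rfl
  | .inr (.inr (.inl a)) => rfl
  | .inr (.inr (.inr x)) => exact (h𝓡 x.2).1

theorem basisPair_noCommonTail (h𝓡 : 𝓡 ⊆ pairsA k l)
    (i : (Fin k → ℤ) ⊕ StdNonzeroPath k l ⊕ StdNonzeroPath k l ⊕ 𝓡) :
    NoCommonTail (basisPair 𝓡 i).1 (basisPair 𝓡 i).2 := by
  match i with
  | .inl v => exact noCommonTail_of_deg_left (deg_nil v)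
  | .inr (.inl a) => exact noCommonTail_of_deg_right (deg_nil _)
  | .inr (.inr (.inl a)) => exact noCommonTail_of_deg_left (deg_nil _)
  | .inr (.inr (.inr x)) => exact (h𝓡 x.2).2

/-- Which of the two words are empty tells the four kinds of basis elements apart; within the last
kind, the uniqueness of representatives decides. -/
theorem basisPair_injective_of_lv [NeZero k] (h𝓡 : IsRepresentativeSet 𝓡)
    (i j : (Fin k → ℤ) ⊕ StdNonzeroPath k l ⊕ StdNonzeroPath k l ⊕ 𝓡)
    (hr₁ : (basisPair 𝓡 i).1.rng = (basisPair 𝓡 j).1.rng)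
    (hr₂ : (basisPair 𝓡 i).2.rng = (basisPair 𝓡 j).2.rng)
    (hl₁ : (basisPair 𝓡 i).1.lv = (basisPair 𝓡 j).1.lv)
    (hl₂ : (basisPair 𝓡 i).2.lv = (basisPair 𝓡 j).2.lv) : i = j := by
  match i, j with
  | .inl v, .inl w => exact congrArg Sum.inl hr₁
  | .inl v, .inr (.inl b) => exact absurd hl₁.symm (lv_ne_nil b)
  | .inl v, .inr (.inr (.inl b)) => exact absurd hl₂.symm (lv_ne_nil b)
  | .inl v, .inr (.inr (.inr y)) => exact absurd hl₁.symm (lv_ne_nil y.1.1)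
  | .inr (.inl a), .inl w => exact absurd hl₁ (lv_ne_nil a)
  | .inr (.inl a), .inr (.inl b) =>
    exact congrArg (fun c => Sum.inr (Sum.inl c)) (Subtype.ext (StdPath.ext hr₁ hr₂ hl₁))
  | .inr (.inl a), .inr (.inr (.inl b)) => exact absurd hl₁ (lv_ne_nil a)
  | .inr (.inl a), .inr (.inr (.inr y)) => exact absurd hl₂.symm (lv_ne_nil y.1.2)
  | .inr (.inr (.inl a)), .inl w => exact absurd hl₂ (lv_ne_nil a)
  | .inr (.inr (.inl a)), .inr (.inl b) => exact absurd hl₂ (lv_ne_nil a)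
  | .inr (.inr (.inl a)), .inr (.inr (.inl b)) =>
    exact congrArg (fun c => Sum.inr (Sum.inr (Sum.inl c)))
      (Subtype.ext (StdPath.ext hr₂ hr₁ hl₂))
  | .inr (.inr (.inl a)), .inr (.inr (.inr y)) => exact absurd hl₁.symm (lv_ne_nil y.1.1)
  | .inr (.inr (.inr x)), .inl w => exact absurd hl₁ (lv_ne_nil x.1.1)
  | .inr (.inr (.inr x)), .inr (.inl b) => exact absurd hl₂ (lv_ne_nil x.1.2)
  | .inr (.inr (.inr x)), .inr (.inr (.inl b)) => exact absurd hl₁ (lv_ne_nil x.1.1)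
  | .inr (.inr (.inr x)), .inr (.inr (.inr y)) =>
    have hx := h𝓡.1 x.2
    have hy := h𝓡.1 y.2
    refine congrArg (fun c => Sum.inr (Sum.inr (Sum.inr c))) (Subtype.ext ?_)
    exact (h𝓡.2 x.1 hx).unique ⟨x.2, pairEquiv_of_lv_eq hx.1 hx.1 rfl rfl rfl rfl⟩
      ⟨y.2, pairEquiv_of_lv_eq hx.1 hy.1 hr₁ hr₂ hl₁ hl₂⟩

theorem pathOf_mul_ghostOf_mem_span [NeZero k] (h𝓡 : IsRepresentativeSet 𝓡) (a b : StdPath k l)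
    (hs : a.src = b.src) (hA : NoCommonTail a b) :
    pathOf (Λ := stdKGraph k l) R a * ghostOf (Λ := stdKGraph k l) R b ∈
      Submodule.span R (Set.range fun i =>
        pathOf (Λ := stdKGraph k l) R (basisPair 𝓡 i).1 *
          ghostOf (Λ := stdKGraph k l) R (basisPair 𝓡 i).2) := by
  have hmem : ∀ i, (basisPair 𝓡 i).1.rng = a.rng → (basisPair 𝓡 i).2.rng = b.rng →
      (basisPair 𝓡 i).1.lv = a.lv → (basisPair 𝓡 i).2.lv = b.lv →
      pathOf (Λ := stdKGraph k l) R a * ghostOf (Λ := stdKGraph k l) R b ∈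
      Submodule.span R (Set.range fun i =>
        pathOf (Λ := stdKGraph k l) R (basisPair 𝓡 i).1 *
          ghostOf (Λ := stdKGraph k l) R (basisPair 𝓡 i).2) := by
    intro i h1 h2 h3 h4
    rw [← pathOf_mul_ghostOf_congr R (basisPair_src h𝓡.1 i) hs h1 h2 h3 h4]
    exact Submodule.subset_span ⟨i, rfl⟩
  by_cases ha : a.deg = 0
  · by_cases hb : b.deg = 0
    · refine hmem (.inl a.rng) rfl ?_ (lv_eq_nil ha).symm (lv_eq_nil hb).symm
      rw [← src_eq_rng ha, hs, src_eq_rng hb]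
      rfl
    · refine hmem (.inr (.inr (.inl ⟨b, hb⟩))) ?_ rfl (lv_eq_nil ha).symm rfl
      rw [← src_eq_rng ha, hs]
      rfl
  · by_cases hb : b.deg = 0
    · refine hmem (.inr (.inl ⟨a, ha⟩)) rfl ?_ rfl (lv_eq_nil hb).symm
      rw [← src_eq_rng hb, ← hs]
      rfl
    · have hxA : ((⟨a, ha⟩, ⟨b, hb⟩) : StdNonzeroPath k l × StdNonzeroPath k l) ∈ pairsA k l :=
        ⟨hs, hA⟩
      obtain ⟨y, ⟨hy, hxy⟩, -⟩ := h𝓡.2 _ hxA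
      obtain ⟨h1, h2, h3, h4⟩ := rng_word_eq_of_pairEquiv hxy
      have hyA := h𝓡.1 hy
      -- The representative may have another source, but without common tails its finite words agree
      -- with those of `a` and `b`, which is all that `hmem` needs.
      obtain ⟨h5, h6⟩ := lv_eq_of_word_eq hs hyA.1 h1 h2 h3 h4 hA hyA.2
      exact hmem (.inr (.inr (.inr ⟨y, hy⟩))) h1.symm h2.symm h5.symm h6.symm

end StdPath

open StdPath KGraph.KP in
theorem theorem14 (k l : ℕ) [NeZero k] [NeZero l] (R : Type*) [CommRing R]
    (𝓡 : Set (StdNonzeroPath k l × StdNonzeroPath k l)) (h𝓡 : IsRepresentativeSet 𝓡) :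
    ∃ B : Module.Basis
        ((stdKGraph k l).Vertex ⊕ StdNonzeroPath k l ⊕ StdNonzeroPath k l ⊕ 𝓡) R
        ((stdKGraph k l).KP R),
      (∀ v, B (.inl v) = KGraph.KP.vertex R v) ∧
      (∀ a, B (.inr (.inl a)) = KGraph.KP.path R a) ∧
      (∀ a, B (.inr (.inr (.inl a))) = KGraph.KP.ghost R a) ∧
      (∀ x : 𝓡, B (.inr (.inr (.inr x))) =
        KGraph.KP.path R x.1.1 * KGraph.KP.ghost R x.1.2) := by
  have hli := linearIndependent_pathOf_mul_ghostOf (R := R) (basisPair 𝓡) (basisPair_src h𝓡.1)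
    (fun i j h1 h2 h3 h4 => by
      obtain ⟨h5, h6⟩ := lv_eq_of_word_eq (basisPair_src h𝓡.1 i) (basisPair_src h𝓡.1 j) h1 h2 h3 h4
        (basisPair_noCommonTail h𝓡.1 i) (basisPair_noCommonTail h𝓡.1 j)
      exact basisPair_injective_of_lv h𝓡 i j h1 h2 h5 h6)
  have hsp : ⊤ ≤ Submodule.span R (Set.range fun i =>
      pathOf (Λ := stdKGraph k l) R (basisPair 𝓡 i).1 *
        ghostOf (Λ := stdKGraph k l) R (basisPair 𝓡 i).2) := by
    rw [← spanPairs_eq_top, spanPairs, Submodule.span_le]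
    rintro _ ⟨a, b, h, rfl⟩
    exact pathOf_mul_ghostOf_mem_of_noCommonTail R (pathOf_mul_ghostOf_mem_span h𝓡) a b h
  refine ⟨Module.Basis.mk hli hsp, fun v => ?_, fun a => ?_, fun a => ?_, fun x => ?_⟩ <;>
    refine (Module.Basis.mk_apply hli hsp _).trans ?_
  · simp only [basisPair]
    rw [pathOf_nil, ghostOf_nil]
    exact vertex_mul_self R v
  · simp only [basisPair]
    rw [ghostOf_nil, pathOf_coe (Λ := stdKGraph k l)]
    exact path_mul_vertex R a
  · simp only [basisPair]
    rw [pathOf_nil, ghostOf_coe (Λ := stdKGraph k l)]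
    exact vertex_mul_ghost R a
  · simp only [basisPair]
    rw [pathOf_coe (Λ := stdKGraph k l), ghostOf_coe (Λ := stdKGraph k l)]
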